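/- **Setting.** Let $\Gamma$ be a plumbing graph: a finite tree with vertices $b_j$ ($j\in\mathcal J$) and integer weights $e_j$. Let $L=\mathbb Z^{\mathcal J}$ be the free abelian group on the $b_j$, with the symmetric bilinear form $(b_j,b_j)=e_j$, and, for $i\ne j$, $(b_i,b_j)=1$ if $b_i,b_j$ are joined by an edge and $0$ otherwise. Assume that the form is negative definite. Let $L'=\mathrm{Hom}(L,\mathbb Z)$ and $PD:L\to L'$, $PD(x)=(x,\cdot)$. An element $k\in L'$ is characteristic if $k(b_j)\equiv e_j \pmod 2$ for all $j$; then $\chi_k(x):=-(k(x)+(x,x))/2$. The canonical class $K$ is given by $K(b_j)=-e_j-2$, and $\mathrm{Char}(\Gamma,\mathfrak t_{can})=\{K+2PD(x):x\in L\}$. A graph is rational if $\chi_K(x)\ge 1$ for all $x\in L$ with $x\neq0$ and all coefficients $\ge0$. Assume that $\Gamma$ is almost rational (AR) with distinguished vertex $b_0$: lowering the weight $e_0$ turns $\Gamma$ into a rational graph. **The set $\mathbb K^+$ and its dual.** Write $U^m\otimes k$ for the pair $(m,k)\in\mathbb Z_{\ge0}\times\mathrm{Char}(\Gamma,\mathfrak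 t_{can})$, and $k$ for $U^0\otimes k$. Let $\mathbb K^+=\mathbb K^+(\Gamma,\mathfrak t_{can})$ be the set of equivalence classes of such pairs for the equivalence relation $\sim$ generated by $$U^{m+n}\otimes(k+2PD(b_j))\sim U^m\otimes k\ \text{ if } n\ge0,\qquad U^{m}\otimes(k+2PD(b_j))\sim U^{m-n}\otimes k\ \text{ if } n<0,$$ where $n=-\chi_k(b_j)=(k(b_j)+e_j)/2$. Let $(\mathbb K^+)^*$ be the $\mathbb F_2$-vector space of the functions $f:\mathbb K^+\to\mathbb F_2$ for which there is an $l$ such that $f(U^m\otimes k)=0$ for all $m\ge l$ and all $k$; the operator $U$ acts on it by $(Uf)(U^m\otimes k)=f(U^{m+1}\otimes k)$. Let $k^*$ be the function on $\mathbb K^+$ that is $1$ on the class of $k$ and $0$ on all other classes. **Laufer sequence.** Put $k(0)=K$. Given $k(i)$, let $z_0=k(i)+2PD(b_0)$; as long as there is a $j\neq0$ with $z_m(b_j)=-e_j$, choose such a $j$ and put $z_{m+1}=z_m+2PD(b_j)$; when there is none, stop and put $k(i+1)=z_m$. (This stops after finitely many steps.) Let $\tau(n)=\sum_{i=0}^{n-1}\chi_{k(i)}(b_0)$.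 **Graded root.** For $i\ge0$ let $R_i$ be the tree with vertices $v_i^m$ ($m\in\mathbb Z$, $m\ge\tau(i)$) and edges $[v_i^m,v_i^{m+1}]$. Let $R_\tau$ be the quotient of $\coprod_iR_i$ by: $v_i^m\asymp v_j^{n}$ and $[v_i^m,v_i^{m+1}]\asymp[v_j^n,v_j^{n+1}]$ if and only if $m=n$ and $m\ge\tau(l)$ for all $l$ between $i$ and $j$ (inclusive). A root vertex is a vertex of valency $1$. The map $\Phi_3$ from the vertices of $R_\tau$ to $\mathbb K^+$ sends the class $\overline{v_i^m}$ to the class of $U^{m-\tau(i)}\otimes k(i)$; it is well defined. **Lemma.** Let $k\in\mathrm{Char}(\Gamma,\mathfrak t_{can})$ satisfy $$e_j+2\le k(b_j)\le -e_j-2\qquad\text{for all }j\in\mathcal J.$$ Then, whatever choices of vertices were made in forming the Laufer sequence: 1. $k^*\in(\mathbb K^+)^*$ and $U k^*=0$, that is, $k^*\in\mathrm{Ker}\,U$. 2. There is a unique $i_0\in\mathbb Z_{\ge0}$ with $k=k(i_0)$. 3. The vertex $\overline{v_{i_0}^{\tau(i_0)}}$ is a root vertex of $R_\tau$ (the root vertex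 of the branch corresponding to $\tau(i_0)$), and it is the only vertex that $\Phi_3$ maps to the class of $k$. 4. The element $k(i_0)-K$ has a unique preimage under $PD$; it lies in $2L$, and $i_0$ is the coefficient of $b_0$ in $PD^{-1}(k(i_0)-K)/2$. -/

import Mathlib

/-- A plumbing graph: a finite (connected) tree whose vertices carry integer weights `e_j`. -/
structure PlumbingGraph (V : Type*) where
  graph : SimpleGraph V
  weight : V → ℤ
  isTree : graph.IsTree

namespace PlumbingGraph

variable {V : Type*} [Fintype V] [DecidableEq V]

/-- The generator `b_j` of the lattice `L = ℤ^V`. -/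
def gen (j : V) : V → ℤ := Pi.single j 1

open Classical in
/-- The intersection matrix: weights on the diagonal, `1` for every edge, `0` elsewhere. -/
noncomputable def matrix (Γ : PlumbingGraph V) : Matrix V V ℤ :=
  Matrix.of fun i j => if i = j then Γ.weight i else if Γ.graph.Adj i j then 1 else 0

/-- The intersection form `(·,·)` on `L`. -/
noncomputable def form (Γ : PlumbingGraph V) : LinearMap.BilinForm ℤ (V → ℤ) :=
  Matrix.toBilin' Γ.matrix

/-- Negative definiteness of the intersection form. -/
def IsNegDef (Γ : PlumbingGraph V) : Prop := ∀ x : V → ℤ, x ≠ 0 → Γ.form x x < 0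

/-- `PD : L → L' = Hom(L, ℤ)`, `PD(x) = (x, ·)`. -/
noncomputable def PD (Γ : PlumbingGraph V) : (V → ℤ) →ₗ[ℤ] Module.Dual ℤ (V → ℤ) := Γ.form

/-- Characteristic elements of `L'`: `k(b_j) + e_j` is even for all `j`. -/
def IsCharacteristic (Γ : PlumbingGraph V) (k : Module.Dual ℤ (V → ℤ)) : Prop :=
  ∀ j, Even (k (gen j) + Γ.weight j)

/-- The action of `L` on characteristic elements: `x ∗ k = k + 2 PD(x)`. -/
noncomputable def act (Γ : PlumbingGraph V) (x : V → ℤ) (k : Module.Dual ℤ (V → ℤ)) :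
    Module.Dual ℤ (V → ℤ) := k + (2 : ℤ) • Γ.PD x

/-- The canonical class `K`: the element of `L'` with `K(b_j) = -e_j - 2`. -/
noncomputable def canonical (Γ : PlumbingGraph V) : Module.Dual ℤ (V → ℤ) :=
  ∑ j, (-Γ.weight j - 2) • (LinearMap.proj j : (V → ℤ) →ₗ[ℤ] ℤ)

/-- `χ_k(x) = -(k(x) + (x,x))/2`; the division is exact if `k` is characteristic. -/
noncomputable def chi (Γ : PlumbingGraph V) (k : Module.Dual ℤ (V → ℤ)) (x : V → ℤ) : ℤ :=
  -(k x + Γ.form x x) / 2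

/-- Rational graphs: `χ_K(x) ≥ 1` for every `x > 0` (all coefficients `≥ 0`, and `x ≠ 0`). -/
def IsRational (Γ : PlumbingGraph V) : Prop :=
  ∀ x : V → ℤ, 0 < x → 1 ≤ Γ.chi Γ.canonical x

/-- The same graph, the weight of the vertex `b₀` being replaced by `w`. -/
def setWeight (Γ : PlumbingGraph V) (b₀ : V) (w : ℤ) : PlumbingGraph V where
  graph := Γ.graph
  weight := Function.update Γ.weight b₀ w
  isTree := Γ.isTree

/-- `Γ` is almost rational with distinguished vertex `b₀`: decreasing the weight of `b₀` makes it
rational. (Decreasing weights preserves rationality, so `<` in place of `≤` gives the same notion.) -/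
def IsAlmostRationalAt (Γ : PlumbingGraph V) (b₀ : V) : Prop :=
  ∃ w : ℤ, w ≤ Γ.weight b₀ ∧ (Γ.setWeight b₀ w).IsRational

/-- `Char(Γ, t_can)`: the characteristic elements in the `L`-orbit of the canonical class. -/
def CharCan (Γ : PlumbingGraph V) : Type _ :=
  {k : Module.Dual ℤ (V → ℤ) // Γ.IsCharacteristic k ∧ ∃ x : V → ℤ, k = Γ.act x Γ.canonical}

theorem canonical_gen (Γ : PlumbingGraph V) (j : V) :
    Γ.canonical (gen j) = -Γ.weight j - 2 := by
  simp [canonical, gen, Pi.single_apply]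

theorem form_gen_gen (Γ : PlumbingGraph V) (i j : V) : Γ.form (gen i) (gen j) = Γ.matrix i j := by
  simp [form, gen]

theorem form_gen_self (Γ : PlumbingGraph V) (j : V) : Γ.form (gen j) (gen j) = Γ.weight j := by
  simp [form_gen_gen, matrix]

theorem act_apply (Γ : PlumbingGraph V) (x : V → ℤ) (k : Module.Dual ℤ (V → ℤ)) (y : V → ℤ) :
    Γ.act x k y = k y + 2 * Γ.form x y := by
  simp [act, PD]

theorem act_act (Γ : PlumbingGraph V) (x y : V → ℤ) (k : Module.Dual ℤ (V → ℤ)) :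
    Γ.act x (Γ.act y k) = Γ.act (y + x) k := by
  simp only [act, map_add, smul_add, add_assoc]

namespace CharCan

/-- The canonical class as an element of `Char(Γ, t_can)`. -/
noncomputable def canonical (Γ : PlumbingGraph V) : Γ.CharCan :=
  ⟨Γ.canonical, fun j => by rw [canonical_gen]; exact ⟨-1, by ring⟩, 0, by simp [act]⟩

/-- The class `k + 2 PD(x)`. -/
noncomputable def act {Γ : PlumbingGraph V} (x : V → ℤ) (k : Γ.CharCan) : Γ.CharCan :=
  ⟨Γ.act x k.1, fun j => by
      rw [act_apply, add_right_comm]; exact (k.2.1 j).add (even_two_mul _),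
    by
      obtain ⟨y, hy⟩ := k.2.2
      exact ⟨y + x, by rw [hy, act_act]⟩⟩

end CharCan

/-- The relations `U^{m+n} ⊗ (k + 2 PD(b_j)) ∼ U^m ⊗ k` if `n ≥ 0` and
`U^m ⊗ (k + 2 PD(b_j)) ∼ U^{m-n} ⊗ k` if `n < 0`, where `2n = k(b_j) + e_j`,
that is, `n = -χ_k(b_j)`. The pair `(m, k)` stands for `U^m ⊗ k`. -/
inductive KRel (Γ : PlumbingGraph V) : ℕ × Γ.CharCan → ℕ × Γ.CharCan → Prop
  | of_nonneg (k : Γ.CharCan) (j : V) (m n : ℕ) (h : (n : ℤ) = -Γ.chi k.1 (gen j)) :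
      KRel Γ (m + n, k.act (gen j)) (m, k)
  | of_neg (k : Γ.CharCan) (j : V) (m n : ℕ) (h : -(n : ℤ) = -Γ.chi k.1 (gen j)) (hn : 0 < n) :
      KRel Γ (m, k.act (gen j)) (m + n, k)

/-- `𝕂⁺(Γ, t_can)`: the quotient by the equivalence relation generated by `KRel`. -/
def KPlus (Γ : PlumbingGraph V) : Type _ := Quot Γ.KRel

namespace KPlus

variable {Γ : PlumbingGraph V}

/-- The class of `U^m ⊗ k`. -/
def mk (m : ℕ) (k : Γ.CharCan) : Γ.KPlus := Quot.mk _ (m, k)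

/-- Multiplication by `U`: `U^m ⊗ k ↦ U^{m+1} ⊗ k`. -/
def mulU : Γ.KPlus → Γ.KPlus :=
  Quot.map (fun p => (p.1 + 1, p.2)) (by
    rintro _ _ (⟨k, j, m, n, h⟩ | ⟨k, j, m, n, h, hn⟩)
    · show Γ.KRel (m + n + 1, _) (m + 1, k)
      rw [add_right_comm]
      exact .of_nonneg k j (m + 1) n h
    · show Γ.KRel (m + 1, _) (m + n + 1, k)
      rw [add_right_comm]
      exact .of_neg k j (m + 1) n h hn)

/-- The dual `(𝕂⁺)^*`: the union over `l` of the spaces of `𝔽₂`-valued functions on `𝕂⁺` that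
vanish on the classes of all `U^m ⊗ k` with `m ≥ l`. -/
def dual (Γ : PlumbingGraph V) : Submodule (ZMod 2) (Γ.KPlus → ZMod 2) where
  carrier := {f | ∃ l : ℕ, ∀ m, l ≤ m → ∀ k, f (mk m k) = 0}
  zero_mem' := ⟨0, fun _ _ _ => rfl⟩
  add_mem' := by
    rintro f g ⟨a, ha⟩ ⟨b, hb⟩
    refine ⟨max a b, fun m hm k => ?_⟩
    simp [ha m (le_trans (le_max_left _ _) hm) k, hb m (le_trans (le_max_right _ _) hm) k]
  smul_mem' := by
    rintro c f ⟨a, ha⟩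
    exact ⟨a, fun m hm k => by simp [ha m hm k]⟩

/-- The action of `U` on the dual: `(U f)(U^m ⊗ k) = f(U^{m+1} ⊗ k)`. -/
def dualU (Γ : PlumbingGraph V) : dual Γ →ₗ[ZMod 2] dual Γ where
  toFun f := ⟨fun c => f.1 (mulU c), by
    obtain ⟨l, hl⟩ := f.2
    exact ⟨l, fun m hm k => hl (m + 1) (by omega) k⟩⟩
  map_add' _ _ := rfl
  map_smul' _ _ := rfl

open Classical in
/-- `k^*`: the function that is `1` on the class of `k = U^0 ⊗ k` and `0` on all other classes. -/
noncomputable def star (k : Γ.CharCan) : Γ.KPlus → ZMod 2 := fun c => if c = mk 0 k then 1 else 0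

theorem mk_act (k : Γ.CharCan) (j : V) (a b : ℕ) (h : (a : ℤ) + Γ.chi k.1 (gen j) = b) :
    mk a (k.act (gen j)) = mk b k := by
  rcases le_or_gt b a with hab | hab
  · obtain ⟨n, rfl⟩ := Nat.exists_eq_add_of_le hab
    exact Quot.sound (.of_nonneg k j b n (by push_cast at h; linarith))
  · obtain ⟨n, rfl⟩ := Nat.exists_eq_add_of_lt hab
    exact Quot.sound (.of_neg k j a (n + 1) (by push_cast at h ⊢; linarith) (by omega))

end KPlus

/-- One step of a computational sequence: `z ↦ z + 2 PD(b_j)` for some `j ≠ 0` with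
`z(b_j) = -e_j`. -/
def ComputationStep (Γ : PlumbingGraph V) (b₀ : V) (z z' : Γ.CharCan) : Prop :=
  ∃ j, j ≠ b₀ ∧ z.1 (gen j) = -Γ.weight j ∧ z' = z.act (gen j)

/-- Some computational sequence that starts at `z` stops at `z'`. -/
def StopsAt (Γ : PlumbingGraph V) (b₀ : V) (z z' : Γ.CharCan) : Prop :=
  Relation.ReflTransGen (Γ.ComputationStep b₀) z z' ∧ ∀ j, j ≠ b₀ → z'.1 (gen j) ≠ -Γ.weight j

/-- A Laufer sequence of `Γ` for the canonical spin^c structure and the vertex `b₀`: a possible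
output `k(0), k(1), …` of the algorithm, for some choice of the vertices in its steps. -/
structure LauferSequence (Γ : PlumbingGraph V) (b₀ : V) where
  seq : ℕ → Γ.CharCan
  zero : seq 0 = CharCan.canonical Γ
  succ : ∀ i, Γ.StopsAt b₀ ((seq i).act (gen b₀)) (seq (i + 1))

/-- `τ(n) = ∑_{i < n} χ_{k(i)}(b₀)`. -/
noncomputable def LauferSequence.tau {Γ : PlumbingGraph V} {b₀ : V} (κ : Γ.LauferSequence b₀)
    (n : ℕ) : ℤ := ∑ i ∈ Finset.range n, Γ.chi (κ.seq i).1 (gen b₀)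

end PlumbingGraph

/-! The graded root of a function `τ`. -/

namespace GradedRoot

/-- The vertices `v_i^m`, `m ≥ τ(i)`, of the disjoint union of the trees `R_i`. -/
def PreVertex (τ : ℕ → ℤ) : Type := {p : ℕ × ℤ // τ p.1 ≤ p.2}

/-- `v_i^m ≍ v_j^n` iff `m = n` and `m ≥ τ(l)` for all `l` between `i` and `j`. -/
def setoid (τ : ℕ → ℤ) : Setoid (PreVertex τ) where
  r p q := p.1.2 = q.1.2 ∧ ∀ l ∈ Set.uIcc p.1.1 q.1.1, τ l ≤ p.1.2
  iseqv :=
    { refl := fun p => ⟨rfl, fun l hl => by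
        have h : l = p.1.1 := by simpa using hl
        rw [h]; exact p.2⟩
      symm := fun h => ⟨h.1.symm, fun l hl => h.1 ▸ h.2 l (by rwa [Set.uIcc_comm])⟩
      trans := fun {p q r} h h' => ⟨h.1.trans h'.1, fun l hl => by
        rcases Set.uIcc_subset_uIcc_union_uIcc (b := q.1.1) hl with hl | hl
        · exact h.2 l hl
        · exact h.1 ▸ h'.2 l hl⟩ }

/-- The vertices of the graded root `R_τ`. -/
def Vertex (τ : ℕ → ℤ) : Type := Quotient (setoid τ)

/-- The vertex of `R_τ` that is the class of `v_i^m`. -/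
def vertex (τ : ℕ → ℤ) (i : ℕ) (m : ℤ) (h : τ i ≤ m) : Vertex τ :=
  Quotient.mk (setoid τ) ⟨(i, m), h⟩

/-- The tree `R_τ`: its edges are the images of the edges `[v_i^m, v_i^{m+1}]`, `m ≥ τ(i)`. -/
def graph (τ : ℕ → ℤ) : SimpleGraph (Vertex τ) :=
  SimpleGraph.fromRel fun u v => ∃ (i : ℕ) (m : ℤ) (h : τ i ≤ m),
    u = vertex τ i m h ∧ v = vertex τ i (m + 1) (by omega)

/-- Root vertices: the vertices of valency `1`. -/
def IsRootVertex {τ : ℕ → ℤ} (v : Vertex τ) : Prop := ((graph τ).neighborSet v).encard = 1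

end GradedRoot

namespace PlumbingGraph

variable {V : Type*} [Fintype V] [DecidableEq V] {Γ : PlumbingGraph V}

theorem KPlus.mk_eq_of_reflTransGen {b₀ : V} {z z' : Γ.CharCan}
    (h : Relation.ReflTransGen (Γ.ComputationStep b₀) z z') (m : ℕ) :
    KPlus.mk m z' = KPlus.mk m z := by
  induction h with
  | refl => rfl
  | tail _ hs ih =>
    obtain ⟨j, _, hj, rfl⟩ := hs
    rw [← ih]
    exact KPlus.mk_act _ j m m (by simp [chi, hj, form_gen_self])

theorem LauferSequence.mk_succ {b₀ : V} (κ : Γ.LauferSequence b₀) (i : ℕ) (m : ℤ)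
    (h : κ.tau i ≤ m) (h' : κ.tau (i + 1) ≤ m) :
    KPlus.mk (m - κ.tau (i + 1)).toNat (κ.seq (i + 1)) =
      KPlus.mk (m - κ.tau i).toNat (κ.seq i) := by
  rw [KPlus.mk_eq_of_reflTransGen (κ.succ i).1]
  refine KPlus.mk_act _ _ _ _ ?_
  rw [Int.toNat_of_nonneg (by omega), Int.toNat_of_nonneg (by omega)]
  simp only [tau, Finset.sum_range_succ]
  ring

theorem LauferSequence.mk_eq_of_le {b₀ : V} (κ : Γ.LauferSequence b₀) (m : ℤ) (i j : ℕ)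
    (hij : i ≤ j) (h : ∀ l, i ≤ l → l ≤ j → κ.tau l ≤ m) :
    KPlus.mk (m - κ.tau i).toNat (κ.seq i) = KPlus.mk (m - κ.tau j).toNat (κ.seq j) := by
  induction j, hij using Nat.le_induction with
  | base => rfl
  | succ j hij ih =>
    rw [ih fun l h1 h2 => h l h1 (by omega)]
    exact (κ.mk_succ j m (h j hij (by omega)) (h (j + 1) (by omega) le_rfl)).symm

/-- The map `Φ₃ : 𝒱(R_τ) → 𝕂⁺(Γ, t_can)` that sends the class of `v_i^m` to the class of
`U^{m-τ(i)} ⊗ k(i)`. -/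
noncomputable def LauferSequence.Phi₃ {b₀ : V} (κ : Γ.LauferSequence b₀) :
    GradedRoot.Vertex κ.tau → Γ.KPlus :=
  Quotient.lift (s := GradedRoot.setoid κ.tau)
    (fun p => KPlus.mk (p.1.2 - κ.tau p.1.1).toNat (κ.seq p.1.1)) (by
      rintro ⟨⟨i, m⟩, hi⟩ ⟨⟨j, n⟩, hj⟩ ⟨h, hl⟩
      simp only at h hl ⊢
      subst h
      rcases le_total i j with hij | hij
      · exact κ.mk_eq_of_le m i j hij fun l h1 h2 => hl l (by simp [Set.uIcc_of_le hij, h1, h2])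
      · exact (κ.mk_eq_of_le m j i hij
          fun l h1 h2 => hl l (by simp [Set.uIcc_of_ge hij, h1, h2])).symm)

/-! The algorithm terminates, so Laufer sequences exist. -/

theorem form_comm (Γ : PlumbingGraph V) (x y : V → ℤ) : Γ.form x y = Γ.form y x := by
  have hM : Γ.matrix.transpose = Γ.matrix := by
    ext i j
    by_cases h : i = j
    · simp [matrix, h]
    · simp only [matrix, Matrix.transpose_apply, Matrix.of_apply, h, Ne.symm h, if_false]
      by_cases ha : Γ.graph.Adj i j
      · rw [if_pos ha, if_pos ha.symm]
      · rw [if_neg ha, if_neg fun hb => ha hb.symm]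
  rw [form, Matrix.toBilin'_apply', Matrix.toBilin'_apply', Matrix.dotProduct_mulVec,
    ← Matrix.mulVec_transpose, hM, dotProduct_comm]

theorem cauchy_schwarz (hΓ : Γ.IsNegDef) (x y : V → ℤ) :
    Γ.form x y ^ 2 ≤ Γ.form x x * Γ.form y y := by
  by_cases hy : y = 0
  · simp [hy]
  have hyy := hΓ y hy
  have hle : ∀ w, Γ.form w w ≤ 0 := fun w => by
    by_cases hw : w = 0
    · simp [hw]
    · exact (hΓ w hw).le
  have := hle (Γ.form y y • x - Γ.form x y • y)
  simp only [map_sub, map_smul, LinearMap.sub_apply, LinearMap.smul_apply, smul_eq_mul,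
    Γ.form_comm y x] at this
  nlinarith

theorem exists_PD_eq (Γ : PlumbingGraph V) (f : Module.Dual ℤ (V → ℤ)) :
    ∃ (d : V → ℤ), ∀ x, Γ.form d x = Γ.matrix.det * f x := by
  refine ⟨Matrix.mulVec Γ.matrix.adjugate (fun j => f (gen j)), fun x => ?_⟩
  have hx : f x = ∑ j, x j * f (gen j) := by
    conv_lhs => rw [← Finset.univ_sum_single x, map_sum]
    refine Finset.sum_congr rfl fun j _ => ?_
    have : (Pi.single j (x j) : V → ℤ) = x j • gen j := by
      rw [gen, ← Pi.single_smul]; simp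
    rw [this, map_smul, smul_eq_mul]
  rw [form_comm, form, Matrix.toBilin'_apply', Matrix.mulVec_mulVec, Matrix.mul_adjugate,
    Matrix.smul_mulVec, Matrix.one_mulVec, hx]
  simp [dotProduct, Finset.mul_sum, mul_left_comm]

theorem det_ne_zero (hΓ : Γ.IsNegDef) : Γ.matrix.det ≠ 0 := by
  intro h
  obtain ⟨v, hv, h0⟩ := Matrix.exists_mulVec_eq_zero_iff.mpr h
  have := hΓ v hv
  rw [form, Matrix.toBilin'_apply', h0] at this
  simp at this

theorem exists_stopsAt (hΓ : Γ.IsNegDef) (b₀ : V) (z : Γ.CharCan) : ∃ z', Γ.StopsAt b₀ z z' := by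
  obtain ⟨y, hy⟩ := exists_PD_eq Γ z.1
  obtain ⟨d, hd⟩ := exists_PD_eq Γ (∑ j, (LinearMap.proj j : (V → ℤ) →ₗ[ℤ] ℤ))
  have hN := det_ne_zero hΓ
  set N := Γ.matrix.det
  have hN1 : 1 ≤ N ^ 2 := by have := sq_nonneg N; have := pow_ne_zero 2 hN; omega
  have hle : ∀ w, Γ.form w w ≤ 0 := fun w => by
    by_cases hw : w = 0
    · simp [hw]
    · exact (hΓ w hw).le
  have bound : ∀ x : V → ℤ, z.1 x + Γ.form x x = 0 →
      (∑ j, x j) ^ 2 ≤ Γ.form d d * Γ.form y y := by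
    intro x hx
    have h1 := cauchy_schwarz hΓ y x
    have h2 := cauchy_schwarz hΓ d x
    rw [hy] at h1
    rw [hd] at h2
    simp only [LinearMap.coe_sum, Finset.sum_apply, LinearMap.proj_apply] at h2
    have hz : z.1 x = -Γ.form x x := by linarith
    rw [hz] at h1
    have hq := hle x
    have hqy := hle y
    have hqd := hle d
    have h3 : Γ.form y y ≤ Γ.form x x := by
      rcases hq.lt_or_eq with hlt | heq
      · by_contra! hc
        have h5 : (Γ.form y y - Γ.form x x) * Γ.form x x < 0 :=
          mul_neg_of_pos_of_neg (by linarith) hlt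
        have h6 : Γ.form x x ^ 2 ≤ N ^ 2 * Γ.form x x ^ 2 :=
          le_mul_of_one_le_left (sq_nonneg _) hN1
        linarith
      · rw [heq]; exact hqy
    have h4 : (∑ j, x j) ^ 2 ≤ (N * ∑ j, x j) ^ 2 := by
      rw [mul_pow]; nlinarith [sq_nonneg (∑ j, x j)]
    nlinarith
  by_contra hno
  have run : ∀ n : ℕ, ∃ x : V → ℤ, ∑ j, x j = n ∧ z.1 x + Γ.form x x = 0 ∧
      Relation.ReflTransGen (Γ.ComputationStep b₀) z (z.act x) := by
    intro n
    induction n with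
    | zero =>
      refine ⟨0, by simp, by simp, ?_⟩
      have : z.act 0 = z := Subtype.ext (by simp [CharCan.act, act])
      rw [this]
    | succ n ih =>
      obtain ⟨x, hs, hx, hr⟩ := ih
      have hex : ∃ j, j ≠ b₀ ∧ (z.act x).1 (gen j) = -Γ.weight j := by
        by_contra hc
        push Not at hc
        exact hno ⟨_, hr, hc⟩
      obtain ⟨j, hj0, hj⟩ := hex
      refine ⟨x + gen j, ?_, ?_, hr.tail ⟨j, hj0, hj, Subtype.ext ?_⟩⟩
      · simp [Finset.sum_add_distrib, hs, gen]
      · have hj' : z.1 (gen j) + 2 * Γ.form x (gen j) = -Γ.weight j := by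
          rw [← act_apply]; exact hj
        simp only [map_add, LinearMap.add_apply, form_gen_self, Γ.form_comm (gen j) x]
        linarith
      · exact (Γ.act_act _ _ _).symm
  obtain ⟨x, hs, hx, -⟩ := run (Γ.form d d * Γ.form y y + 1).toNat
  have hb := bound x hx
  rw [hs] at hb
  have := Int.self_le_toNat (Γ.form d d * Γ.form y y + 1)
  have := Int.le_self_sq ((Γ.form d d * Γ.form y y + 1).toNat : ℤ)
  linarith

/-- A negative definite graph has a Laufer sequence. -/
theorem nonempty_lauferSequence (hΓ : Γ.IsNegDef) (b₀ : V) : Nonempty (Γ.LauferSequence b₀) := by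
  choose f hf using exists_stopsAt hΓ b₀
  exact ⟨⟨fun i => Nat.rec (CharCan.canonical Γ) (fun _ k => f (k.act (gen b₀))) i, rfl,
    fun i => hf _⟩⟩

end PlumbingGraph

/-! ### The intersection form in coordinates, and the numerical use of almost rationality. -/

namespace PlumbingGraph

variable {V : Type*} [DecidableEq V] {Γ : PlumbingGraph V}

/-! Everything rests on two facts. First, the bounds on `k` exclude the pair `(0, k)` from every
generating relation of `𝕂⁺`, so its class is a singleton (`mk_eq_mk_zero_iff`). This gives `U k^* =
0`, and an element of the fibre of `Φ₃` over `k` must be `v_j^{τ(j)}` with `k(j) = k`. Second, `k(i)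
= K + 2 PD(x(i))`, where `x(i)` is the least cycle with coefficient `i` at `b₀` that pairs
nonpositively with every other `b_j` (`exists_isLauferCycle`). The coefficient makes `i ↦ k(i)`
injective. If `k = K + 2 PD(x)`, the bounds read `e_j + 2 ≤ (x, b_j) ≤ 0`: the upper one gives `x ≥
x(i)` with `i = x_{b₀} ≥ 0`, and the lower one together with rationality excludes `x ≠ x(i)`. -/

theorem gen_pos (j : V) : 0 < gen j := by
  simp [gen]

theorem matrix_nonneg_of_ne {i j : V} (h : i ≠ j) : 0 ≤ Γ.matrix i j := by
  simp only [matrix, Matrix.of_apply, if_neg h]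
  split_ifs <;> simp

theorem setWeight_matrix (Γ : PlumbingGraph V) (b₀ : V) (w : ℤ) (i j : V) :
    (Γ.setWeight b₀ w).matrix i j =
      Γ.matrix i j + if i = b₀ ∧ j = b₀ then w - Γ.weight b₀ else 0 := by
  by_cases hij : i = j
  · subst hij
    by_cases hi : i = b₀
    · subst hi; simp [matrix, setWeight]
    · simp [matrix, setWeight, hi]
  · have : ¬(i = b₀ ∧ j = b₀) := fun h => hij (h.1.trans h.2.symm)
    rw [if_neg this, add_zero]
    simp only [matrix, setWeight, Matrix.of_apply, if_neg hij]
    rfl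

variable [Fintype V]

theorem dual_apply_eq_sum (f : Module.Dual ℤ (V → ℤ)) (x : V → ℤ) :
    f x = ∑ j, x j * f (gen j) := by
  conv_lhs => rw [← Finset.univ_sum_single x, map_sum]
  refine Finset.sum_congr rfl fun j _ => ?_
  have : (Pi.single j (x j) : V → ℤ) = x j • gen j := by
    rw [gen, ← Pi.single_smul]; simp
  rw [this, map_smul, smul_eq_mul]

theorem form_eq_sum_sum (Γ : PlumbingGraph V) (x y : V → ℤ) :
    Γ.form x y = ∑ i, ∑ j, x i * y j * Γ.matrix i j := by
  rw [dual_apply_eq_sum (Γ.form x) y, Finset.sum_comm]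
  refine Finset.sum_congr rfl fun j _ => ?_
  rw [form_comm, dual_apply_eq_sum, Finset.mul_sum]
  refine Finset.sum_congr rfl fun i _ => ?_
  rw [form_comm, form_gen_gen]
  ring

/-- In a negative definite lattice, `x ≥ 0` as soon as `(x, b_j) ≤ 0` wherever `x_j < 0`. -/
theorem nonneg_of_form_gen_nonpos (hΓ : Γ.IsNegDef) {x : V → ℤ}
    (hx : ∀ j, x j < 0 → Γ.form x (gen j) ≤ 0) : 0 ≤ x := by
  -- With `n` the negative part, `x + n` and `n` have disjoint supports, so `(x + n, n) ≥ 0`. Since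
  -- `(x, n) ≤ 0`, this forces `(n, n) ≥ 0`, hence `n = 0`.
  set n : V → ℤ := fun j => max (-x j) 0 with hn
  have h1 : Γ.form x n ≤ 0 := by
    rw [dual_apply_eq_sum]
    refine Finset.sum_nonpos fun j _ => ?_
    rcases lt_or_ge (x j) 0 with h | h
    · exact mul_nonpos_of_nonneg_of_nonpos (le_max_right _ _) (hx j h)
    · simp [hn, h]
  have h2 : 0 ≤ Γ.form (x + n) n := by
    rw [form_eq_sum_sum]
    refine Finset.sum_nonneg fun i _ => Finset.sum_nonneg fun j _ => ?_
    rcases eq_or_ne i j with rfl | hij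
    · have : (x + n) i * n i = 0 := by
        rcases le_total (x i) 0 with h | h
        · simp [hn, h]
        · simp [hn, h]
      rw [this, zero_mul]
    · refine mul_nonneg (mul_nonneg ?_ (le_max_right _ _)) (matrix_nonneg_of_ne hij)
      have := le_max_left (-x i) 0
      simp only [Pi.add_apply, hn]
      linarith
  rw [map_add, LinearMap.add_apply] at h2
  have h3 : n = 0 := by
    by_contra h
    have := hΓ n h
    linarith
  intro j
  have h4 := congrFun h3 j
  have h5 := le_max_left (-x j) 0
  simp only [hn, Pi.zero_apply] at h4 ⊢
  linarith

theorem setWeight_form (Γ : PlumbingGraph V) (b₀ : V) (w : ℤ) (x y : V → ℤ) :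
    (Γ.setWeight b₀ w).form x y = Γ.form x y + x b₀ * y b₀ * (w - Γ.weight b₀) := by
  rw [form_eq_sum_sum, form_eq_sum_sum]
  simp only [setWeight_matrix, mul_add, Finset.sum_add_distrib]
  congr 1
  rw [Finset.sum_eq_single b₀ (fun i _ hi => by simp [hi]) (by simp),
    Finset.sum_eq_single b₀ (fun i _ hi => by simp [hi]) (by simp)]
  simp

theorem setWeight_canonical (Γ : PlumbingGraph V) (b₀ : V) (w : ℤ) (x : V → ℤ) :
    (Γ.setWeight b₀ w).canonical x = Γ.canonical x - x b₀ * (w - Γ.weight b₀) := by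
  rw [dual_apply_eq_sum, dual_apply_eq_sum Γ.canonical, eq_sub_iff_add_eq]
  simp only [canonical_gen]
  have : x b₀ * (w - Γ.weight b₀) = ∑ j, if j = b₀ then x j * (w - Γ.weight b₀) else 0 := by simp
  rw [this, ← Finset.sum_add_distrib]
  refine Finset.sum_congr rfl fun j _ => ?_
  by_cases hj : j = b₀
  · subst hj; simp [setWeight]; ring
  · simp [setWeight, hj]

/-- In an almost rational graph, `2 χ_K(y) ≥ 2` for every `y > 0` whose coefficient at the
distinguished vertex is `0` or `1`. -/
theorem IsAlmostRationalAt.canonical_add_form_le {b₀ : V} (h : Γ.IsAlmostRationalAt b₀)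
    {y : V → ℤ} (hy : 0 < y) (hy₀ : y b₀ = 0 ∨ y b₀ = 1) :
    Γ.canonical y + Γ.form y y ≤ -2 := by
  obtain ⟨w, -, hw⟩ := h
  have := hw y hy
  rw [chi, setWeight_canonical, setWeight_form] at this
  -- Changing the weight adds `(y₀² - y₀)(w - e₀)` to `K(y) + (y, y)`, where `y₀ = y b₀`; this
  -- vanishes for `y₀ = 0, 1`.
  rcases hy₀ with h | h <;> rw [h] at this <;> omega

theorem PD_injective (hΓ : Γ.IsNegDef) : Function.Injective Γ.PD := by
  intro x y h
  by_contra hne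
  have h1 := hΓ (x - y) (sub_ne_zero.mpr hne)
  have h2 : Γ.form (x - y) = 0 := by
    rw [map_sub, sub_eq_zero]; exact h
  simp [h2] at h1

theorem act_injective (hΓ : Γ.IsNegDef) (k : Module.Dual ℤ (V → ℤ)) :
    Function.Injective fun x => Γ.act x k := by
  intro x y h
  refine PD_injective hΓ ?_
  have h1 : (2 : ℤ) • Γ.PD x = (2 : ℤ) • Γ.PD y := add_left_cancel h
  ext j
  have h2 := LinearMap.congr_fun h1 (Pi.single j 1)
  simp only [LinearMap.smul_apply, smul_eq_mul] at h2
  simpa using h2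

theorem canonical_act_gen (Γ : PlumbingGraph V) (x : V → ℤ) (j : V) :
    Γ.act x Γ.canonical (gen j) = -Γ.weight j - 2 + 2 * Γ.form x (gen j) := by
  rw [act_apply, canonical_gen]

/-! ### Minimal cycles and the Laufer sequence. -/

/-- `x` is the least element of `L` with coefficient `i` at `b₀` and `(x, b_j) ≤ 0` for all
`j ≠ b₀`. -/
structure IsLauferCycle (Γ : PlumbingGraph V) (b₀ : V) (i : ℕ) (x : V → ℤ) : Prop where
  coeff : x b₀ = i
  form_gen_nonpos : ∀ j, j ≠ b₀ → Γ.form x (gen j) ≤ 0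
  le : ∀ y : V → ℤ, y b₀ = i → (∀ j, j ≠ b₀ → Γ.form y (gen j) ≤ 0) → x ≤ y

theorem isLauferCycle_zero (hΓ : Γ.IsNegDef) (b₀ : V) : Γ.IsLauferCycle b₀ 0 0 where
  coeff := rfl
  form_gen_nonpos := by simp
  le y hy h := nonneg_of_form_gen_nonpos hΓ fun j hj => h j (by rintro rfl; simp [hy] at hj)

/-- A computational sequence stays below every bound that is
anti-nef away from `b₀`, keeps `χ_K` constant, and only changes the coefficients away from `b₀`. -/
theorem exists_of_reflTransGen {b₀ : V} {x : V → ℤ} {z z' : Γ.CharCan}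
    (hz : z.1 = Γ.act x Γ.canonical)
    (h : Relation.ReflTransGen (Γ.ComputationStep b₀) z z') :
    ∃ d : V → ℤ, z'.1 = Γ.act (x + d) Γ.canonical ∧ 0 ≤ d ∧ d b₀ = 0 ∧
      Γ.canonical (x + d) + Γ.form (x + d) (x + d) = Γ.canonical x + Γ.form x x ∧
      ∀ y, x ≤ y → (∀ j, j ≠ b₀ → Γ.form y (gen j) ≤ 0) → x + d ≤ y := by
  induction h with
  | refl => exact ⟨0, by simpa using hz, le_rfl, rfl, by simp,
    fun y hxy _ => by simpa using hxy⟩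
  | @tail u _ _ hs ih =>
    obtain ⟨j, hj, hu, rfl⟩ := hs
    obtain ⟨d, hd, hd0, hdb, hq, hle⟩ := ih
    -- The rule `z(b_j) = -e_j` says that the cycle pairs to `1` with `b_j`; twice this cancels
    -- `K(b_j) + (b_j, b_j) = -2`.
    have hone : Γ.form (x + d) (gen j) = 1 := by
      rw [hd, canonical_act_gen] at hu
      linarith
    refine ⟨d + gen j, ?_, add_nonneg hd0 (gen_pos j).le, ?_, ?_, ?_⟩
    · rw [← add_assoc, ← act_act, ← hd]; rfl
    · simp [hdb, gen, hj.symm]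
    · have h1 : Γ.form (x + d + gen j) (x + d + gen j) =
          Γ.form (x + d) (x + d) + Γ.form (x + d) (gen j) +
            (Γ.form (gen j) (x + d) + Γ.form (gen j) (gen j)) := by
        rw [map_add Γ.form (x + d), LinearMap.add_apply, map_add (Γ.form (x + d)) (x + d),
          map_add (Γ.form (gen j)) (x + d)]
      rw [← add_assoc, ← hq, h1, map_add Γ.canonical (x + d), canonical_gen, form_gen_self,
        Γ.form_comm (gen j) (x + d), hone]
      ring
    · intro y hxy hy
      have h1 := hle y hxy hy
      have h2 : (x + d) j < y j := by
        refine lt_of_le_of_ne (h1 j) fun heq => ?_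
        -- If the bound were attained at `j`, the difference would be effective without `b_j`, hence
        -- pair nonnegatively with `b_j`; but `(y, b_j) ≤ 0 < 1`.
        have h3 : 0 ≤ Γ.form (gen j) (y - (x + d)) := by
          rw [dual_apply_eq_sum]
          refine Finset.sum_nonneg fun i _ => ?_
          rw [form_gen_gen]
          rcases eq_or_ne j i with rfl | hij
          · simp [← heq]
          · exact mul_nonneg (sub_nonneg.mpr (h1 i)) (matrix_nonneg_of_ne hij)
        rw [map_sub, Γ.form_comm _ y, Γ.form_comm _ (x + d), hone] at h3
        linarith [hy j hj]
      intro i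
      rw [← add_assoc]
      rcases eq_or_ne i j with rfl | hij
      · simpa [gen] using h2
      · simpa [gen, hij] using h1 i

/-- The algorithm moves only at pairing exactly `1`, so it might stop at a pairing `≥ 2`.
Rationality rules this out, so the output really is anti-nef away from `b₀`. -/
theorem IsLauferCycle.exists_succ {b₀ : V} (hAR : Γ.IsAlmostRationalAt b₀) {i : ℕ} {x : V → ℤ}
    (hx : Γ.IsLauferCycle b₀ i x) {k k' : Γ.CharCan} (hk : k.1 = Γ.act x Γ.canonical)
    (h : Γ.StopsAt b₀ (k.act (gen b₀)) k') :
    ∃ x', k'.1 = Γ.act x' Γ.canonical ∧ Γ.IsLauferCycle b₀ (i + 1) x' := by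
  have hk₀ : (k.act (gen b₀)).1 = Γ.act (x + gen b₀) Γ.canonical := by
    rw [← act_act, ← hk]; rfl
  obtain ⟨d, hd, hd0, hdb, hq, hle⟩ := exists_of_reflTransGen hk₀ h.1
  refine ⟨_, hd, ?_, fun j hj => ?_, fun y hy hy' => hle y ?_ hy'⟩
  · simp [gen, hdb, hx.coeff]
  · by_contra! hpos
    have hne : Γ.form (x + gen b₀ + d) (gen j) ≠ 1 := fun h1 => h.2 j hj (by
      rw [hd, canonical_act_gen, h1]; ring)
    have h2 : 2 ≤ Γ.form (x + gen b₀ + d) (gen j) := by omega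
    have hpos' : 0 < gen b₀ + (d + gen j) :=
      add_pos_of_pos_of_nonneg (gen_pos b₀) (add_nonneg hd0 (gen_pos j).le)
    -- For `c = b₀ + d + b_j`, constancy of `χ_K` gives `K(c) + (c, c) = -4 - 2(x, d + b_j) + 2(x +
    -- b₀ + d, b_j) ≥ 0`, against the bound `-2`.
    have hr := hAR.canonical_add_form_le hpos' (Or.inr (by simp [gen, hdb, hj.symm]))
    have hnon : Γ.form x (d + gen j) ≤ 0 := by
      rw [dual_apply_eq_sum]
      refine Finset.sum_nonpos fun l _ => ?_
      rcases eq_or_ne l b₀ with rfl | hl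
      · simp [gen, hdb, hj.symm]
      · exact mul_nonpos_of_nonneg_of_nonpos ((add_nonneg hd0 (gen_pos j).le) l)
          (hx.form_gen_nonpos l hl)
    simp only [map_add, LinearMap.add_apply, canonical_gen, form_gen_self, Γ.form_comm _ x,
      Γ.form_comm d (gen _), Γ.form_comm (gen j) (gen b₀)] at hr hq h2 hnon
    linarith
  -- Removing `b₀` only lowers the pairings with the other `b_j`, so minimality of `x` applies to `y
  -- - b₀`.
  · have h1 := hx.le (y - gen b₀) (by simp [gen, hy]) fun j hj => by
      rw [map_sub, LinearMap.sub_apply, form_gen_gen]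
      linarith [hy' j hj, matrix_nonneg_of_ne (Γ := Γ) hj.symm]
    exact le_sub_iff_add_le.mp h1

theorem LauferSequence.exists_isLauferCycle (hΓ : Γ.IsNegDef) {b₀ : V}
    (hAR : Γ.IsAlmostRationalAt b₀) (κ : Γ.LauferSequence b₀) (i : ℕ) :
    ∃ x, (κ.seq i).1 = Γ.act x Γ.canonical ∧ Γ.IsLauferCycle b₀ i x := by
  induction i with
  | zero => exact ⟨0, by rw [κ.zero]; simp [CharCan.canonical, act], isLauferCycle_zero hΓ b₀⟩
  | succ i ih =>
    obtain ⟨x, hx, hL⟩ := ih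
    exact hL.exists_succ hAR hx (κ.succ i)

theorem LauferSequence.seq_injective (hΓ : Γ.IsNegDef) {b₀ : V} (hAR : Γ.IsAlmostRationalAt b₀)
    (κ : Γ.LauferSequence b₀) : Function.Injective κ.seq := by
  intro i j h
  obtain ⟨x, hx, hi⟩ := κ.exists_isLauferCycle hΓ hAR i
  obtain ⟨y, hy, hj⟩ := κ.exists_isLauferCycle hΓ hAR j
  have hxy : x = y := act_injective hΓ Γ.canonical (hx.symm.trans ((congrArg _ h).trans hy))
  have := hi.coeff.symm.trans ((congrFun hxy b₀).trans hj.coeff)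
  exact_mod_cast this

/-- Let `y = x(i)` and `d = x - y ≥ 0`, which has coefficient `0` at `b₀`. Then `K(d) + (d, d) =
(K(d) + (x, d)) - (y, d) ≥ 0`, which rationality forbids unless `d = 0`. -/
theorem LauferSequence.exists_eq_seq (hΓ : Γ.IsNegDef) {b₀ : V} (hAR : Γ.IsAlmostRationalAt b₀)
    (κ : Γ.LauferSequence b₀) {k : Γ.CharCan}
    (hk : ∀ j, Γ.weight j + 2 ≤ k.1 (gen j) ∧ k.1 (gen j) ≤ -Γ.weight j - 2) :
    ∃ i, k = κ.seq i := by
  obtain ⟨x, hx⟩ := k.2.2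
  have hx1 : ∀ j, Γ.form x (gen j) ≤ 0 := fun j => by
    have := (hk j).2
    rw [hx, canonical_act_gen] at this
    linarith
  have hx2 : ∀ j, Γ.weight j + 2 ≤ Γ.form x (gen j) := fun j => by
    have := (hk j).1
    rw [hx, canonical_act_gen] at this
    linarith
  have hx0 : 0 ≤ x := nonneg_of_form_gen_nonpos hΓ fun j _ => hx1 j
  obtain ⟨i, hi⟩ := Int.eq_ofNat_of_zero_le (hx0 b₀)
  obtain ⟨y, hy, hL⟩ := κ.exists_isLauferCycle hΓ hAR i
  refine ⟨i, Subtype.ext ?_⟩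
  have hd0 : 0 ≤ x - y := sub_nonneg.mpr (hL.le x hi fun j _ => hx1 j)
  have hdb : (x - y) b₀ = 0 := by simp [hi, hL.coeff]
  by_cases hd : x - y = 0
  · rw [hx, hy, sub_eq_zero.mp hd]
  exfalso
  have hr := hAR.canonical_add_form_le (lt_of_le_of_ne hd0 (Ne.symm hd)) (Or.inl hdb)
  have h1 : Γ.form y (x - y) ≤ 0 := by
    rw [dual_apply_eq_sum]
    refine Finset.sum_nonpos fun l _ => ?_
    rcases eq_or_ne l b₀ with rfl | hl
    · simp [hdb]
    · exact mul_nonpos_of_nonneg_of_nonpos (hd0 l) (hL.form_gen_nonpos l hl)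
  have h2 : 0 ≤ (Γ.canonical + Γ.form x) (x - y) := by
    rw [dual_apply_eq_sum]
    refine Finset.sum_nonneg fun l _ => mul_nonneg (hd0 l) ?_
    rw [LinearMap.add_apply, canonical_gen]
    linarith [hx2 l]
  rw [LinearMap.add_apply] at h2
  rw [map_sub Γ.form, LinearMap.sub_apply] at hr
  linarith

/-! ### Singleton classes in `𝕂⁺`. -/

namespace KPlus

/-- A characteristic element that satisfies the strict adjunction bounds at `±b_j` for every `j`
is alone in its class. -/
theorem mk_eq_mk_zero_iff {k : Γ.CharCan}
    (hk : ∀ j, Γ.weight j + 2 ≤ k.1 (gen j) ∧ k.1 (gen j) ≤ -Γ.weight j - 2)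
    (m : ℕ) (k' : Γ.CharCan) : mk m k' = mk 0 k ↔ m = 0 ∧ k' = k := by
  refine ⟨fun h => ?_, by rintro ⟨rfl, rfl⟩; rfl⟩
  have step : ∀ p q, Γ.KRel p q → (p = (0, k) ↔ q = (0, k)) := by
    have key : ∀ (c : Γ.CharCan) (j : V), (c.act (gen j)).1 (gen j) =
        c.1 (gen j) + 2 * Γ.weight j := fun c j => by
      rw [← form_gen_self]; exact Γ.act_apply _ _ _
    -- Were `(0, k)` an end of a relation, its exponent `0` would force `k(b_j) ≥ -e_j - 1` at the
    -- `c` end or `k(b_j) ≤ e_j` at the `c + 2 PD(b_j)` end.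
    rintro _ _ (⟨c, j, m, n, h⟩ | ⟨c, j, m, n, h, hn⟩) <;>
      rw [chi, form_gen_self] at h <;> have hc := key c j <;>
      refine iff_of_false (fun he => ?_) (fun he => ?_) <;>
      simp only [Prod.mk.injEq] at he <;> obtain ⟨he1, he2⟩ := he <;>
      have hkj := hk j <;> rw [← he2] at hkj <;> omega
  have : ∀ p q, Relation.EqvGen Γ.KRel p q → (p = (0, k) ↔ q = (0, k)) := by
    intro p q hpq
    induction hpq with
    | rel _ _ h => exact step _ _ h
    | refl _ => rfl
    | symm _ _ _ ih => exact ih.symm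
    | trans _ _ _ _ _ ih ih' => exact ih.trans ih'
  exact Prod.mk.inj ((this _ _ (Quot.eqvGen_exact h)).mpr rfl)

end KPlus

theorem LauferSequence.Phi₃_vertex {b₀ : V} (κ : Γ.LauferSequence b₀) (i : ℕ) (m : ℤ)
    (h : κ.tau i ≤ m) : κ.Phi₃ (GradedRoot.vertex κ.tau i m h) =
      KPlus.mk (m - κ.tau i).toNat (κ.seq i) := rfl

end PlumbingGraph

/-! ### Root vertices of the graded root. -/

namespace GradedRoot

/-- A vertex `v_i^{τ(i)}` whose class contains no other `v_j^m` is a root vertex. -/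
theorem isRootVertex_of_forall {τ : ℕ → ℤ} {i : ℕ}
    (hi : ∀ (j : ℕ) (m : ℤ) (h : τ j ≤ m), vertex τ j m h = vertex τ i (τ i) le_rfl →
      j = i ∧ m = τ i) : IsRootVertex (vertex τ i (τ i) le_rfl) := by
  have hN : (graph τ).neighborSet (vertex τ i (τ i) le_rfl) =
      {vertex τ i (τ i + 1) (by omega)} := by
    ext u
    rw [SimpleGraph.mem_neighborSet, graph, SimpleGraph.fromRel_adj, Set.mem_singleton_iff]
    constructor
    · rintro ⟨-, ⟨j, m, h, hv, hu⟩ | ⟨j, m, h, -, hv⟩⟩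
      · obtain ⟨rfl, rfl⟩ := hi j m h hv.symm
        exact hu
      -- An edge from below would start at `v_i^{τ(i)-1}`, which does not exist.
      · obtain ⟨rfl, hm⟩ := hi j (m + 1) _ hv.symm
        omega
    · rintro rfl
      refine ⟨fun h => ?_, Or.inl ⟨i, τ i, le_rfl, rfl, rfl⟩⟩
      have := (hi i (τ i + 1) _ h.symm).2
      omega
  rw [IsRootVertex, hN, Set.encard_singleton]

end GradedRoot

/-! ### Assembly of the four claims. -/

theorem lemma5p2 {V : Type*} [Fintype V] [DecidableEq V] (Γ : PlumbingGraph V)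
    (hΓ : Γ.IsNegDef) (b₀ : V) (hAR : Γ.IsAlmostRationalAt b₀) (κ : Γ.LauferSequence b₀)
    (k : Γ.CharCan)
    (hk : ∀ j, Γ.weight j + 2 ≤ k.1 (PlumbingGraph.gen j) ∧
      k.1 (PlumbingGraph.gen j) ≤ -Γ.weight j - 2) :
    (∃ h : PlumbingGraph.KPlus.star k ∈ PlumbingGraph.KPlus.dual Γ,
        PlumbingGraph.KPlus.dualU Γ ⟨PlumbingGraph.KPlus.star k, h⟩ = 0) ∧
    (∃! i₀ : ℕ, k = κ.seq i₀) ∧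
    ∀ i₀ : ℕ, k = κ.seq i₀ →
      GradedRoot.IsRootVertex (GradedRoot.vertex κ.tau i₀ (κ.tau i₀) le_rfl) ∧
      κ.Phi₃ ⁻¹' {PlumbingGraph.KPlus.mk 0 k} =
          {GradedRoot.vertex κ.tau i₀ (κ.tau i₀) le_rfl} ∧
      ∃ x : V → ℤ, (∀ y : V → ℤ, Γ.PD y = (κ.seq i₀).1 - Γ.canonical ↔ y = (2 : ℤ) • x) ∧
        x b₀ = (i₀ : ℤ) := by
  obtain ⟨i, hi⟩ := κ.exists_eq_seq hΓ hAR hk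
  have hinj := κ.seq_injective hΓ hAR
  have hstar : ∀ m, 1 ≤ m → ∀ c : Γ.CharCan,
      PlumbingGraph.KPlus.star k (PlumbingGraph.KPlus.mk m c) = 0 := fun m hm c => by
    refine if_neg fun h => ?_
    have := ((PlumbingGraph.KPlus.mk_eq_mk_zero_iff hk m c).mp h).1
    omega
  refine ⟨⟨⟨1, hstar⟩, ?_⟩, ⟨i, hi, fun j hj => hinj (hj.symm.trans hi)⟩, fun i₀ hi₀ => ?_⟩
  · refine Subtype.ext (funext fun c => ?_)
    obtain ⟨⟨m, c⟩, rfl⟩ := Quot.exists_rep c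
    exact hstar (m + 1) (by omega) c
  have hPhi : ∀ (j : ℕ) (m : ℤ) (h : κ.tau j ≤ m),
      κ.Phi₃ (GradedRoot.vertex κ.tau j m h) = PlumbingGraph.KPlus.mk 0 k →
        j = i₀ ∧ m = κ.tau i₀ := fun j m h hm => by
    rw [κ.Phi₃_vertex, PlumbingGraph.KPlus.mk_eq_mk_zero_iff hk] at hm
    obtain rfl := hinj (hm.2.trans hi₀)
    exact ⟨rfl, by omega⟩
  have hself : κ.Phi₃ (GradedRoot.vertex κ.tau i₀ (κ.tau i₀) le_rfl) =
      PlumbingGraph.KPlus.mk 0 k := by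
    rw [κ.Phi₃_vertex, sub_self, hi₀]; rfl
  -- The singleton fibre of `Φ₃` also shows that no other `v_j^m` is glued to `v_{i₀}^{τ(i₀)}`.
  refine ⟨GradedRoot.isRootVertex_of_forall fun j m h hv => hPhi j m h (hv ▸ hself), ?_, ?_⟩
  · ext v
    refine ⟨fun hv => ?_, by rintro rfl; exact hself⟩
    obtain ⟨⟨⟨j, m⟩, h⟩, rfl⟩ := Quotient.exists_rep v
    obtain ⟨rfl, rfl⟩ := hPhi j m h hv
    rfl
  · obtain ⟨x, hx, hL⟩ := κ.exists_isLauferCycle hΓ hAR i₀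
    refine ⟨x, fun y => ?_, hL.coeff⟩
    have : (κ.seq i₀).1 - Γ.canonical = Γ.PD ((2 : ℤ) • x) := by
      rw [hx, PlumbingGraph.act, map_smul, add_sub_cancel_left]
    rw [this]
    exact (PlumbingGraph.PD_injective hΓ).eq_iff
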